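/- **Setting.** For an integer $d\ge 1$ let $P$ be a Borel distribution of $(X,Y)$ on $\mathbb{R}^d\times\{0,1\}$, with marginal $P_X$, regression function $\eta(x)=P(Y=1\mid X=x)$ and Bayes classifier $M^*(x)=\mathbf 1_{\{\eta(x)\ge 1/2\}}$. For a bounded set $U\subset\mathbb{R}^d$ with non-empty interior and $K>0$, let $\mathcal{BA}_K(U)$ be the set of measurable $f:U\to\mathbb{R}$ such that for every integer $N\ge1$ there is a ReLU network $g(x)=\sum_{i=1}^N c_i\max\{\langle a_i,x\rangle+b_i,0\}+c_0$ with $\sup_{x\in U}|f(x)-g(x)|\le\sqrt d\,K N^{-1/2}$ all of whose weights and biases (entries of the $a_i$, and $b_i,c_i,c_0$) are bounded in absolute value by $$\sqrt K\Bigl(5+\inf_{x_0\in U}\bigl[\|x_0\|_1+\vartheta(U,x_0)\bigr]\Bigr),\qquad \vartheta(U,x_0)=\sup_{\xi\ne0}\frac{\|\xi\|_\infty}{\sup_{x\in U}|\langle\xi,x-x_0\rangle|}.$$ Put $\mathcal{BA}(U)=\bigcup_{K>0}\mathcal{BA}_K(U)$ (the Barron approximation space). Fix $\alpha\ge0$,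 $C_0>0$ and $\kappa\in(0,1/2)$. Let $\Sigma=\Sigma_d(\alpha,C_0,\kappa)$ be the class of all $P$ for which some Borel version $\eta:\mathbb{R}^d\to[0,1]$ of the regression function satisfies: 1. $P_X(0<|\eta(X)-1/2|\le t)\le C_0t^\alpha$ for all $t>0$; 2. $\kappa\le\eta(X)\le1-\kappa$ almost surely; 3. $P_X$ is supported on a compact set $\Omega\subset\mathbb{R}^d$; 4. for some integer $M\ge1$ there are non-empty bounded open sets $U_1,\dots,U_M$ covering $\Omega$ with $\eta|_{U_i}\in\mathcal{BA}(U_i)$ for every $i$. ($\Omega$, $M$, the $U_i$ and the constants $K$ may depend on $P$.) For $n\ge1$ let $$R_n(\Sigma)=\inf_{\widehat f_n}\ \sup_{P\in\Sigma}\ E\bigl[P(\widehat f_n(X)\ne Y)-P(M^*(X)\ne Y)\bigr],$$ where the infimum is over all jointly measurable classifiers $\widehat f_n:\mathbb{R}^d\times(\mathbb{R}^d\times\{0,1\})^n\to\{0,1\}$ and the expectation is over the $n$ i.i.d. samples from $P$ on which $\widehat f_n$ depends. **Theorem.** There is a constant $C>0$, depending only on $\alpha,C_0,\kappa$, such that for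 every $d\ge 1$ the following hold. (i) For all positive integers $n,q,m$ and all real $r>0$, $w>0$ with $m\le q^d$, $w\le 1/m$ and $wm\le q^{-r\alpha}/2^\alpha$, $$R_n(\Sigma)\ \ge\ C\,q^{-r}\,m\,w\,\bigl(1-q^{-r}\sqrt{nw}\bigr).$$ (ii) For every $\overline C\ge2$ there is $C'>0$ (not depending on $n$) such that for every $n\ge1$ the choices $$r=\frac{d}{2(2+\alpha)},\qquad q=\Bigl\lfloor\overline C\,n^{\frac1{3r(2+\alpha)}}\Bigr\rfloor,\qquad m=q^d,\qquad w=\frac{q^{-\alpha r-d}}{2^\alpha}$$ are admissible in (i), the right-hand side of (i) is then at least $C'n^{-\frac{1+\alpha}{3(2+\alpha)}}$, and consequently $$R_n(\Sigma)\ \ge\ C'\,n^{-\frac{1+\alpha}{3(2+\alpha)}}.$$ -/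

import Mathlib

open MeasureTheory ProbabilityTheory

noncomputable section

namespace BarronMinimax

/-- A feed-forward ReLU network on `ℝ^d` with one hidden layer of `N` neurons. -/
structure ShallowNet (d N : ℕ) where
  innerWeight : Fin N → Fin d → ℝ
  innerBias : Fin N → ℝ
  outerWeight : Fin N → ℝ
  outerBias : ℝ

/-- The function realized by the network:
`x ↦ ∑ i, cᵢ · max (∑ j, aᵢⱼ xⱼ + bᵢ) 0 + c₀`. -/
def ShallowNet.eval {d N : ℕ} (g : ShallowNet d N) (x : EuclideanSpace ℝ (Fin d)) : ℝ :=
  ∑ i, g.outerWeight i * max (∑ j, g.innerWeight i j * x j + g.innerBias i) 0 + g.outerBias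

/-- All weights (including the additive constants) have absolute value at most `B`. -/
def ShallowNet.WeightsBoundedBy {d N : ℕ} (g : ShallowNet d N) (B : ℝ) : Prop :=
  (∀ i j, |g.innerWeight i j| ≤ B) ∧ (∀ i, |g.innerBias i| ≤ B) ∧
    (∀ i, |g.outerWeight i| ≤ B) ∧ |g.outerBias| ≤ B

/-- `|ξ|_{U,x₀} = sup_{x ∈ U} |⟨ξ, x - x₀⟩|` (finite, as `U` is bounded). -/
def supPairing {d : ℕ} (U : Set (EuclideanSpace ℝ (Fin d))) (x₀ ξ : EuclideanSpace ℝ (Fin d)) :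
    ℝ :=
  ⨆ x : U, |inner ℝ ξ ((x : EuclideanSpace ℝ (Fin d)) - x₀)|

/-- `ϑ(U,x₀) = sup_{ξ ≠ 0} ‖ξ‖_∞ / |ξ|_{U,x₀}`
(finite when `U` is bounded with non-empty interior). -/
def vartheta {d : ℕ} (U : Set (EuclideanSpace ℝ (Fin d))) (x₀ : EuclideanSpace ℝ (Fin d)) : ℝ :=
  ⨆ ξ : {ξ : EuclideanSpace ℝ (Fin d) // ξ ≠ 0},
    (⨆ j : Fin d, |(ξ : EuclideanSpace ℝ (Fin d)) j|) / supPairing U x₀ ξ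

/-- The bound `√C · (5 + inf_{x₀ ∈ U} (‖x₀‖₁ + ϑ(U,x₀)))` on the network weights. -/
def weightBound {d : ℕ} (C : ℝ) (U : Set (EuclideanSpace ℝ (Fin d))) : ℝ :=
  √C * (5 + ⨅ x₀ : U, ((∑ j, |(x₀ : EuclideanSpace ℝ (Fin d)) j|) + vartheta U x₀))

/-- The class `BA_C(U)` (meant for bounded `U` with non-empty interior). -/
def barronApproxBall {d : ℕ} (C : ℝ) (U : Set (EuclideanSpace ℝ (Fin d))) : Set (U → ℝ) :=
  {f | Measurable f ∧ ∀ N : ℕ, 1 ≤ N → ∃ g : ShallowNet d N,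
      (∀ x : U, |f x - g.eval x| ≤ √(d : ℝ) * C * (N : ℝ) ^ (-(1 / 2) : ℝ)) ∧
      g.WeightsBoundedBy (weightBound C U)}

/-- The Barron approximation space `BA(U) = ⋃_{C > 0} BA_C(U)`. -/
def barronApproxSpace {d : ℕ} (U : Set (EuclideanSpace ℝ (Fin d))) : Set (U → ℝ) :=
  {f | ∃ C : ℝ, 0 < C ∧ f ∈ barronApproxBall C U}

/-- The regression function `x ↦ P(Y = 1 | X = x)`, through the regular conditional
distribution of the label given the input. -/
def regressionFn {d : ℕ} (P : ProbabilityMeasure (EuclideanSpace ℝ (Fin d) × Fin 2))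
    (x : EuclideanSpace ℝ (Fin d)) : ℝ :=
  ((P : Measure (EuclideanSpace ℝ (Fin d) × Fin 2)).condKernel x).real {1}

/-- The Bayes classifier `M* = 1{η ≥ 1/2}`. -/
def bayesClassifier {d : ℕ} (P : ProbabilityMeasure (EuclideanSpace ℝ (Fin d) × Fin 2))
    (x : EuclideanSpace ℝ (Fin d)) : Fin 2 :=
  open scoped Classical in if 1 / 2 ≤ regressionFn P x then 1 else 0

/-- The class `Σ` of distributions of `(X,Y)`, for the margin exponent `α` and constant `C₀` and
the distance `κ` of the regression function from `0` and `1`. The Barron condition is pointwise,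
so it is imposed on some version `η` of the regression function; the compact set, the cover, and
the Barron constants may depend on `P`. -/
def distributionClass (d : ℕ) (α C₀ κ : ℝ) :
    Set (ProbabilityMeasure (EuclideanSpace ℝ (Fin d) × Fin 2)) :=
  {P | ∃ η : EuclideanSpace ℝ (Fin d) → ℝ,
    Measurable η ∧ (∀ x, η x ∈ Set.Icc (0 : ℝ) 1) ∧
    η =ᵐ[(P : Measure (EuclideanSpace ℝ (Fin d) × Fin 2)).fst] regressionFn P ∧
    -- margin assumption
    (∀ t : ℝ, 0 < t → (P : Measure (EuclideanSpace ℝ (Fin d) × Fin 2)).fst.real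
      {x | 0 < |η x - 1 / 2| ∧ |η x - 1 / 2| ≤ t} ≤ C₀ * t ^ α) ∧
    -- bounded away from `0` and `1`
    (∀ᵐ x ∂(P : Measure (EuclideanSpace ℝ (Fin d) × Fin 2)).fst, κ ≤ η x ∧ η x ≤ 1 - κ) ∧
    -- compact support, and local membership in the Barron approximation space
    ∃ Ω : Set (EuclideanSpace ℝ (Fin d)), IsCompact Ω ∧
      (P : Measure (EuclideanSpace ℝ (Fin d) × Fin 2)).fst Ωᶜ = 0 ∧
      ∃ M : ℕ, 0 < M ∧ ∃ U : Fin M → Set (EuclideanSpace ℝ (Fin d)),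
        Ω ⊆ ⋃ i, U i ∧
        ∀ i, IsOpen (U i) ∧ (U i).Nonempty ∧ Bornology.IsBounded (U i) ∧
          (fun x : U i => η x) ∈ barronApproxSpace (U i)}

/-- A (jointly measurable) classifier built from `n` labelled samples. -/
structure Classifier (d n : ℕ) where
  toFun : (Fin n → EuclideanSpace ℝ (Fin d) × Fin 2) → EuclideanSpace ℝ (Fin d) → Fin 2
  measurable_toFun : Measurable (Function.uncurry toFun)

/-- `E[P(f(X) ≠ Y) - P(M*(X) ≠ Y)]`, the outer expectation being over `n` i.i.d. samples
from `P`. -/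
def excessRisk {d n : ℕ} (f : Classifier d n)
    (P : ProbabilityMeasure (EuclideanSpace ℝ (Fin d) × Fin 2)) : ℝ :=
  ∫ D : Fin n → EuclideanSpace ℝ (Fin d) × Fin 2,
    ((P : Measure (EuclideanSpace ℝ (Fin d) × Fin 2)).real {z | f.toFun D z.1 ≠ z.2} -
      (P : Measure (EuclideanSpace ℝ (Fin d) × Fin 2)).real {z | bayesClassifier P z.1 ≠ z.2})
    ∂(Measure.pi fun _ : Fin n => (P : Measure (EuclideanSpace ℝ (Fin d) × Fin 2)))

/-- The minimax excess risk over `S`; the infimum and supremum are taken in the extended reals. -/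
def minimaxExcessRisk {d : ℕ} (n : ℕ)
    (S : Set (ProbabilityMeasure (EuclideanSpace ℝ (Fin d) × Fin 2))) : EReal :=
  ⨅ f : Classifier d n, ⨆ P ∈ S, ((excessRisk f P : ℝ) : EReal)

end BarronMinimax

end

namespace BarronMinimax

/-! The class allows purely atomic input distributions, so an Assouad hypercube of discrete laws
suffices. Put mass `w` on each of `m` separated points, where the regression function is `1 / 2 ±
h`, and the remaining mass on one more point where it equals `1 / 2`. Around each point a small ball
carries a constant version of the regression function, and a constant is a one-layer network with
zero weights. The Barron condition is therefore free, and only the margin condition restricts `m *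
w` (`mem_distributionClass`).

A wrong guess at an atom costs `2 * h * w` (`excessRisk_cube`). Flipping one sign keeps the
Hellinger affinity of the two laws above `1 - 4 * h ^ 2 * w` (`sub_le_sum_sqrt_flip`). Affinity
tensorizes over the sample and bounds the error of every test from below (`two_point_lower_bound`).
Averaging over all sign vectors yields one that is bad for the given classifier
(`exists_le_sum_error`). Then `le_minimaxExcessRisk` scales `h` and `w` to fit the margin constants,
and `rate_choice` is the exponent arithmetic. -/

/-! ### Finitely supported distributions: risk and regression function. -/

/-- The sign `±1` attached to a label. -/
noncomputable def labelSign : Fin 2 → ℝ := ![-1, 1]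

/-- The joint weight of `(i, y)` when `i` has mass `v i` and regression value `1 / 2 + θ i`. -/
noncomputable def atomWeight {ι : Type*} (v θ : ι → ℝ) (z : ι × Fin 2) : ℝ :=
  v z.1 * (1 / 2 + labelSign z.2 * θ z.1)

theorem abs_labelSign (y : Fin 2) : |labelSign y| = 1 := by
  fin_cases y <;> simp [labelSign]

theorem labelSign_sub_mul (a b : Fin 2) :
    (labelSign b - labelSign a) * labelSign b = if a ≠ b then 2 else 0 := by
  fin_cases a <;> fin_cases b <;> norm_num [labelSign]

theorem atomWeight_nonneg {ι : Type*} {v θ : ι → ℝ} (hv : ∀ i, 0 ≤ v i)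
    (hθ : ∀ i, |θ i| ≤ 1 / 2) (z : ι × Fin 2) : 0 ≤ atomWeight v θ z := by
  refine mul_nonneg (hv _) ?_
  have h : |labelSign z.2 * θ z.1| ≤ 1 / 2 := by
    rw [abs_mul, abs_labelSign, one_mul]; exact hθ _
  linarith [(abs_le.1 h).1]

theorem sum_atomWeight_label {ι : Type*} (v θ : ι → ℝ) (i : ι) :
    ∑ y, atomWeight v θ (i, y) = v i := by
  simp only [atomWeight, labelSign, Fin.sum_univ_two, Matrix.cons_val_zero, Matrix.cons_val_one]
  ring

theorem sum_atomWeight {ι : Type*} [Fintype ι] (v θ : ι → ℝ) :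
    ∑ z, atomWeight v θ z = ∑ i, v i := by
  rw [Fintype.sum_prod_type]
  exact Finset.sum_congr rfl fun i _ => sum_atomWeight_label v θ i

theorem exists_isProbabilityMeasure_real_singleton {Z : Type*} [Fintype Z] [MeasurableSpace Z]
    [MeasurableSingletonClass Z] (p : Z → ℝ) (hp : ∀ z, 0 ≤ p z) (hsum : ∑ z, p z = 1) :
    ∃ μ : Measure Z, IsProbabilityMeasure μ ∧ ∀ z, μ.real {z} = p z := by
  have h : ∑ z, ENNReal.ofReal (p z) = 1 := by
    rw [← ENNReal.ofReal_sum_of_nonneg fun z _ => hp z, hsum, ENNReal.ofReal_one]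
  refine ⟨(PMF.ofFintype _ h).toMeasure, inferInstance, fun z => ?_⟩
  rw [measureReal_def, PMF.toMeasure_apply_singleton _ _ (measurableSet_singleton z),
    PMF.ofFintype_apply, ENNReal.toReal_ofReal (hp z)]

theorem measurableEmbedding_of_finite {A B : Type*} [Finite A] [MeasurableSpace A]
    [MeasurableSingletonClass A] [MeasurableSpace B] [MeasurableSingletonClass B] {φ : A → B}
    (hφ : Function.Injective φ) : MeasurableEmbedding φ :=
  ⟨hφ, measurable_of_finite φ, fun {s} _ => (s.toFinite.image φ).measurableSet⟩

/-- Both the law and its `n`-fold product are pushforwards from finite spaces along measurable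
embeddings, so the expectation reduces to a finite sum. -/
theorem excessRisk_map {d n : ℕ} {ι : Type*} [Fintype ι] [MeasurableSpace ι]
    [MeasurableSingletonClass ι] (f : Classifier d n) {x : ι → EuclideanSpace ℝ (Fin d)}
    (hx : Function.Injective x) (μ : Measure (ι × Fin 2)) [IsProbabilityMeasure μ]
    (P : ProbabilityMeasure (EuclideanSpace ℝ (Fin d) × Fin 2))
    (hP : (P : Measure (EuclideanSpace ℝ (Fin d) × Fin 2)) = μ.map (Prod.map x id)) :
    excessRisk f P = ∑ D : Fin n → ι × Fin 2, (∏ k, μ.real {D k}) *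
      (μ.real {z | f.toFun (Prod.map x id ∘ D) (x z.1) ≠ z.2} -
        μ.real {z | bayesClassifier P (x z.1) ≠ z.2}) := by
  have hφ : Function.Injective (Prod.map x (id : Fin 2 → Fin 2)) :=
    hx.prodMap Function.injective_id
  have hemb := measurableEmbedding_of_finite hφ
  have hembn : MeasurableEmbedding
      (fun D : Fin n → ι × Fin 2 => fun k => Prod.map x (id : Fin 2 → Fin 2) (D k)) :=
    measurableEmbedding_of_finite fun D D' h => funext fun k => hφ (congrFun h k)
  have : IsProbabilityMeasure (μ.map (Prod.map x (id : Fin 2 → Fin 2))) := hP ▸ inferInstance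
  unfold excessRisk
  simp only [hP]
  rw [← Measure.pi_map_pi (fun _ => hemb.measurable.aemeasurable), hembn.integral_map,
    integral_fintype .of_finite]
  refine Finset.sum_congr rfl fun D _ => ?_
  rw [smul_eq_mul, measureReal_def, Measure.pi_singleton, ENNReal.toReal_prod]
  simp only [measureReal_def, hemb.map_apply]
  rfl

theorem measureReal_label_ne {ι : Type*} [Fintype ι] [MeasurableSpace ι]
    [MeasurableSingletonClass ι] {v θ : ι → ℝ} (μ : Measure (ι × Fin 2)) [IsProbabilityMeasure μ]
    (hμ : ∀ z, μ.real {z} = atomWeight v θ z) (g : ι → Fin 2) :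
    μ.real {z | g z.1 ≠ z.2} = ∑ i, v i * (1 / 2 - labelSign (g i) * θ i) := by
  classical
  have h : {z : ι × Fin 2 | g z.1 ≠ z.2} =
      ((Finset.univ.filter fun z : ι × Fin 2 => g z.1 ≠ z.2 : Finset _) : Set _) := by
    ext; simp
  rw [h, ← sum_measureReal_singleton, Finset.sum_filter, Fintype.sum_prod_type]
  refine Finset.sum_congr rfl fun i _ => ?_
  simp only [hμ, atomWeight, labelSign, Fin.sum_univ_two]
  generalize g i = y
  fin_cases y <;> simp [sub_eq_add_neg]

/-- At an atom of positive mass the conditional kernel is the elementary quotient, so its value is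
determined there and not merely almost everywhere. -/
theorem regressionFn_map {d : ℕ} {ι : Type*} [Fintype ι] [MeasurableSpace ι]
    [MeasurableSingletonClass ι] {x : ι → EuclideanSpace ℝ (Fin d)}
    (hx : Function.Injective x) {v θ : ι → ℝ} (hv : ∀ i, 0 < v i)
    (μ : Measure (ι × Fin 2)) [IsProbabilityMeasure μ]
    (hμ : ∀ z, μ.real {z} = atomWeight v θ z)
    (P : ProbabilityMeasure (EuclideanSpace ℝ (Fin d) × Fin 2))
    (hP : (P : Measure (EuclideanSpace ℝ (Fin d) × Fin 2)) = μ.map (Prod.map x id)) (i : ι) :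
    regressionFn P (x i) = 1 / 2 + θ i := by
  have hφ : Function.Injective (Prod.map x (id : Fin 2 → Fin 2)) :=
    hx.prodMap Function.injective_id
  have hemb := measurableEmbedding_of_finite hφ
  have hfst : (P : Measure (EuclideanSpace ℝ (Fin d) × Fin 2)).fst.real {x i} = v i := by
    rw [measureReal_def, Measure.fst_apply (measurableSet_singleton _), hP, hemb.map_apply,
      ← measureReal_def]
    have : Prod.map x (id : Fin 2 → Fin 2) ⁻¹' (Prod.fst ⁻¹' {x i}) =
        ((Finset.univ.map ⟨fun y : Fin 2 => (i, y), Prod.mk_right_injective i⟩ : Finset _) :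
          Set (ι × Fin 2)) := by
      ext ⟨j, y⟩
      simp [hx.eq_iff, eq_comm]
    rw [this, ← sum_measureReal_singleton, Finset.sum_map]
    simp only [Function.Embedding.coeFn_mk, hμ]
    exact sum_atomWeight_label v θ i
  have hne : (P : Measure (EuclideanSpace ℝ (Fin d) × Fin 2)).fst {x i} ≠ 0 := by
    intro h
    rw [measureReal_def, h] at hfst
    exact (hv i).ne hfst
  have hjoint : (P : Measure (EuclideanSpace ℝ (Fin d) × Fin 2)).real ({x i} ×ˢ {1}) =
      v i * (1 / 2 + θ i) := by
    rw [measureReal_def, hP, hemb.map_apply, ← measureReal_def]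
    have : Prod.map x (id : Fin 2 → Fin 2) ⁻¹' ({x i} ×ˢ {1}) = {(i, 1)} := by
      ext ⟨j, y⟩
      simp [hx.eq_iff]
    rw [this, hμ]
    simp [atomWeight, labelSign]
  rw [regressionFn, measureReal_def, Measure.condKernel_apply_of_ne_zero hne, ENNReal.toReal_mul,
    ENNReal.toReal_inv, ← measureReal_def, ← measureReal_def, hfst, hjoint,
    inv_mul_cancel_left₀ (hv i).ne']

/-! ### Membership in the class: locally constant regression functions. -/

theorem five_le_weightBound {d : ℕ} (U : Set (EuclideanSpace ℝ (Fin d))) :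
    5 ≤ weightBound 1 U := by
  -- Real suprema and infima of nonnegative families are nonnegative even when empty or unbounded
  -- (default value `0`), so no finiteness of `vartheta` is needed.
  have h : 0 ≤ ⨅ x₀ : U, ((∑ j, |(x₀ : EuclideanSpace ℝ (Fin d)) j|) + vartheta U x₀) :=
    Real.iInf_nonneg fun x₀ => add_nonneg (Finset.sum_nonneg fun _ _ => abs_nonneg _)
      (Real.iSup_nonneg fun ξ => div_nonneg (Real.iSup_nonneg fun _ => abs_nonneg _)
        (Real.iSup_nonneg fun _ => abs_nonneg _))
  rw [weightBound, Real.sqrt_one]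
  linarith

theorem const_mem_barronApproxSpace {d : ℕ} (U : Set (EuclideanSpace ℝ (Fin d))) {c : ℝ}
    (hc : |c| ≤ 1) : (fun _ : U => c) ∈ barronApproxSpace U := by
  have h5 := five_le_weightBound U
  refine ⟨1, one_pos, measurable_const, fun N _ =>
    ⟨⟨fun _ _ => 0, fun _ => 0, fun _ => 0, c⟩, fun x => ?_, ?_⟩⟩
  · simp only [ShallowNet.eval, zero_mul, Finset.sum_const_zero, zero_add, sub_self, abs_zero]
    positivity
  · simp only [ShallowNet.WeightsBoundedBy, abs_zero]
    exact ⟨fun _ _ => by linarith, fun _ => by linarith, fun _ => by linarith, by linarith⟩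

/-- The point `(i + 1 / 2, 0, …, 0)`. -/
noncomputable def gridPoint (k : ℕ) {M : ℕ} (i : Fin M) : EuclideanSpace ℝ (Fin (k + 1)) :=
  EuclideanSpace.single 0 ((i : ℝ) + 1 / 2)

theorem gridPoint_injective (k M : ℕ) : Function.Injective (gridPoint k (M := M)) := by
  intro i j h
  have h0 := congrArg (fun y : EuclideanSpace ℝ (Fin (k + 1)) => y 0) h
  simp only [gridPoint, PiLp.single_apply, if_true] at h0
  exact Fin.ext (by exact_mod_cast add_right_cancel h0)

/-- The function `1 / 2 + θ i` on the slab of points with `⌊y 0⌋ = i`. -/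
noncomputable def slabFn (k : ℕ) {M : ℕ} (θ : Fin M → ℝ)
    (y : EuclideanSpace ℝ (Fin (k + 1))) : ℝ :=
  1 / 2 + if h : ⌊y 0⌋₊ < M then θ ⟨⌊y 0⌋₊, h⟩ else 0

theorem measurable_slabFn (k : ℕ) {M : ℕ} (θ : Fin M → ℝ) : Measurable (slabFn k θ) :=
  (measurable_from_top (f := fun N : ℕ => 1 / 2 + if h : N < M then θ ⟨N, h⟩ else 0)).comp
    (Nat.measurable_floor.comp (by fun_prop : Measurable
      fun y : EuclideanSpace ℝ (Fin (k + 1)) => y 0))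

/-- The ball of radius `1 / 2` about the midpoint of a unit slab stays inside that slab. Hence one
globally measurable function is constant on every set of the cover. -/
theorem slabFn_eq_of_dist_lt {k M : ℕ} (θ : Fin M → ℝ) (i : Fin M)
    {y : EuclideanSpace ℝ (Fin (k + 1))} (hy : dist y (gridPoint k i) < 1 / 2) :
    slabFn k θ y = 1 / 2 + θ i := by
  have h : |y 0 - ((i : ℝ) + 1 / 2)| < 1 / 2 := by
    refine lt_of_le_of_lt ?_ hy
    have := PiLp.norm_apply_le (y - gridPoint k i) 0
    rw [dist_eq_norm]
    simpa [gridPoint] using this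
  obtain ⟨h1, h2⟩ := abs_lt.1 h
  have hfl : ⌊y 0⌋₊ = i := by
    rw [Nat.floor_eq_iff (by have : (0 : ℝ) ≤ (i : ℕ) := Nat.cast_nonneg _; linarith)]
    constructor <;> linarith
  rw [slabFn, dif_pos (hfl ▸ i.2)]
  congr 2
  exact Fin.ext hfl

theorem mem_distributionClass {k M : ℕ} {α C₀ κ : ℝ} (hM : 0 < M) (hκ : 0 < κ) {v θ : Fin M → ℝ}
    (hv : ∀ i, 0 < v i) (hθ : ∀ i, |θ i| ≤ 1 / 2 - κ)
    (hmargin : ∀ t : ℝ, 0 < t →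
      ∑ i, (if 0 < |θ i| ∧ |θ i| ≤ t then v i else 0) ≤ C₀ * t ^ α)
    (μ : Measure (Fin M × Fin 2)) [IsProbabilityMeasure μ]
    (hμ : ∀ z, μ.real {z} = atomWeight v θ z)
    (P : ProbabilityMeasure (EuclideanSpace ℝ (Fin (k + 1)) × Fin 2))
    (hP : (P : Measure (EuclideanSpace ℝ (Fin (k + 1)) × Fin 2)) =
      μ.map (Prod.map (gridPoint k) id)) :
    P ∈ distributionClass (k + 1) α C₀ κ := by
  have hx := gridPoint_injective k M
  have hslab : ∀ i, slabFn k θ (gridPoint k i) = 1 / 2 + θ i := fun i =>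
    slabFn_eq_of_dist_lt θ i (by simp)
  have hfst : (P : Measure (EuclideanSpace ℝ (Fin (k + 1)) × Fin 2)).fst =
      μ.map fun z => gridPoint k z.1 := by
    rw [hP, Measure.fst, Measure.map_map measurable_fst (measurable_of_finite _)]
    rfl
  have hae : ∀ p : EuclideanSpace ℝ (Fin (k + 1)) → Prop, (∀ i : Fin M, p (gridPoint k i)) →
      ∀ᵐ y ∂(P : Measure (EuclideanSpace ℝ (Fin (k + 1)) × Fin 2)).fst, p y := by
    intro p hp
    have hfin : (Set.range (gridPoint k (M := M))).Finite := Set.finite_range _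
    have : ∀ᵐ y ∂(P : Measure (EuclideanSpace ℝ (Fin (k + 1)) × Fin 2)).fst,
        y ∈ Set.range (gridPoint k (M := M)) := by
      rw [hfst]
      exact (ae_map_iff (measurable_of_finite _).aemeasurable hfin.measurableSet).2
        (Filter.Eventually.of_forall fun z => Set.mem_range_self z.1)
    filter_upwards [this] with y hy
    obtain ⟨i, rfl⟩ := hy
    exact hp i
  have habs : ∀ i, κ ≤ 1 / 2 + θ i ∧ 1 / 2 + θ i ≤ 1 - κ := fun i => by
    obtain ⟨h1, h2⟩ := abs_le.1 (hθ i)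
    constructor <;> linarith
  refine ⟨slabFn k θ, measurable_slabFn k θ, fun y => ?_, ?_, fun t ht => ?_, ?_,
    Set.range (gridPoint k (M := M)), (Set.finite_range _).isCompact, ?_, M, hM,
    fun i => Metric.ball (gridPoint k i) (1 / 2), ?_, fun i =>
      ⟨Metric.isOpen_ball, ⟨_, Metric.mem_ball_self (by norm_num)⟩, Metric.isBounded_ball, ?_⟩⟩
  · rw [slabFn]
    split_ifs with h
    · obtain ⟨h1, h2⟩ := habs ⟨⌊y 0⌋₊, h⟩
      constructor <;> linarith
    · norm_num
  · exact hae _ fun i => by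
      rw [hslab, regressionFn_map hx hv μ hμ P hP]
  · have hmeas : Measurable (slabFn k θ) := measurable_slabFn k θ
    have hset : MeasurableSet {y | 0 < |slabFn k θ y - 1 / 2| ∧ |slabFn k θ y - 1 / 2| ≤ t} := by
      have h1 : Measurable fun y => |slabFn k θ y - 1 / 2| := by fun_prop
      exact (measurableSet_lt measurable_const h1).inter (measurableSet_le h1 measurable_const)
    rw [hfst, measureReal_def, Measure.map_apply (measurable_of_finite _) hset,
      ← measureReal_def]
    classical
    have hpre : (fun z : Fin M × Fin 2 => gridPoint k z.1) ⁻¹'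
          {y | 0 < |slabFn k θ y - 1 / 2| ∧ |slabFn k θ y - 1 / 2| ≤ t} =
        ((Finset.univ.filter fun z : Fin M × Fin 2 => 0 < |θ z.1| ∧ |θ z.1| ≤ t : Finset _) :
          Set _) := by
      ext z
      simp [hslab]
    rw [hpre, ← sum_measureReal_singleton, Finset.sum_filter, Fintype.sum_prod_type]
    refine le_trans (le_of_eq (Finset.sum_congr rfl fun i _ => ?_)) (hmargin t ht)
    split_ifs
    · simp only [hμ, sum_atomWeight_label]
    · simp
  · exact hae _ fun i => by rw [hslab]; exact habs i
  · exact hae _ fun i => Set.mem_range_self i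
  · rintro _ ⟨i, rfl⟩
    exact Set.mem_iUnion.2 ⟨i, Metric.mem_ball_self (by norm_num)⟩
  · have : (fun y : Metric.ball (gridPoint k i) (1 / 2) => slabFn k θ y) =
        fun _ => 1 / 2 + θ i := funext fun y => slabFn_eq_of_dist_lt θ i y.2
    rw [this]
    refine const_mem_barronApproxSpace _ (abs_le.2 ?_)
    obtain ⟨h1, h2⟩ := habs i
    constructor <;> linarith

/-! ### Two-point testing through the Hellinger affinity. -/

/-- Le Cam's inequality: write `p * q` as `min * max`, apply Cauchy–Schwarz, and bound the total of
the maxima by `2`. -/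
theorem sq_sum_sqrt_mul_le {Z : Type*} [Fintype Z] {p q : Z → ℝ} (hp : ∀ z, 0 ≤ p z)
    (hq : ∀ z, 0 ≤ q z) (hp1 : ∑ z, p z = 1) (hq1 : ∑ z, q z = 1) :
    (∑ z, √(p z * q z)) ^ 2 ≤ 2 * ∑ z, min (p z) (q z) := by
  have hmin : ∀ z, 0 ≤ min (p z) (q z) := fun z => le_min (hp z) (hq z)
  have hmax : ∀ z, 0 ≤ max (p z) (q z) := fun z => le_max_of_le_left (hp z)
  calc (∑ z, √(p z * q z)) ^ 2
      = (∑ z, √(min (p z) (q z)) * √(max (p z) (q z))) ^ 2 := by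
        simp_rw [← Real.sqrt_mul (hmin _), min_mul_max]
    _ ≤ (∑ z, √(min (p z) (q z)) ^ 2) * ∑ z, √(max (p z) (q z)) ^ 2 :=
        Finset.sum_mul_sq_le_sq_mul_sq _ _ _
    _ = (∑ z, min (p z) (q z)) * ∑ z, max (p z) (q z) := by
        simp_rw [Real.sq_sqrt (hmin _), Real.sq_sqrt (hmax _)]
    _ ≤ (∑ z, min (p z) (q z)) * 2 := by
        refine mul_le_mul_of_nonneg_left ?_ (Finset.sum_nonneg fun z _ => hmin z)
        calc ∑ z, max (p z) (q z) ≤ ∑ z, (p z + q z) :=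
              Finset.sum_le_sum fun z _ => max_le_add_of_nonneg (hp z) (hq z)
          _ = 2 := by rw [Finset.sum_add_distrib, hp1, hq1]; norm_num
    _ = 2 * ∑ z, min (p z) (q z) := mul_comm _ _

theorem sum_prod_pi {Z : Type*} [Fintype Z] (n : ℕ) (p : Z → ℝ) :
    ∑ D : Fin n → Z, ∏ k, p (D k) = (∑ z, p z) ^ n := by
  classical
  have h := Finset.prod_univ_sum (fun _ : Fin n => (Finset.univ : Finset Z)) fun _ z => p z
  rw [Finset.prod_const, Finset.card_univ, Fintype.card_fin, Fintype.piFinset_univ] at h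
  exact h.symm

/-- The two errors of a test add up to at least the sum of the pointwise minima; the affinity of the
product laws is the `n`-th power. -/
theorem two_point_lower_bound {Z : Type*} [Fintype Z] (n : ℕ) {p q : Z → ℝ} (hp : ∀ z, 0 ≤ p z)
    (hq : ∀ z, 0 ≤ q z) (hp1 : ∑ z, p z = 1) (hq1 : ∑ z, q z = 1)
    (A : (Fin n → Z) → Prop) [DecidablePred A] :
    (∑ z, √(p z * q z)) ^ (2 * n) / 2 ≤
      ∑ D : Fin n → Z, if A D then ∏ k, p (D k) else ∏ k, q (D k) := by
  have h := sq_sum_sqrt_mul_le (p := fun D : Fin n → Z => ∏ k, p (D k))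
    (q := fun D => ∏ k, q (D k)) (fun D => Finset.prod_nonneg fun k _ => hp _)
    (fun D => Finset.prod_nonneg fun k _ => hq _) (by rw [sum_prod_pi, hp1, one_pow])
    (by rw [sum_prod_pi, hq1, one_pow])
  simp_rw [← Finset.prod_mul_distrib,
    Real.sqrt_prod _ fun (z : Fin n) _ => mul_nonneg (hp _) (hq _)] at h
  rw [sum_prod_pi n fun z => √(p z * q z), ← pow_mul, mul_comm n 2] at h
  have hle : ∑ D : Fin n → Z, min (∏ k, p (D k)) (∏ k, q (D k)) ≤
      ∑ D : Fin n → Z, if A D then ∏ k, p (D k) else ∏ k, q (D k) :=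
    Finset.sum_le_sum fun D _ => by
      split_ifs
      exacts [min_le_left _ _, min_le_right _ _]
  linarith

/-! ### The hypercube of distributions and Assouad's argument. -/

/-- The masses `w, …, w, 1 - m w`. -/
noncomputable def cubeMass (m : ℕ) (w : ℝ) : Fin (m + 1) → ℝ :=
  Fin.snoc (fun _ : Fin m => w) (1 - m * w)

/-- The offsets `± h, …, ± h, 0`. -/
noncomputable def cubeOffset {m : ℕ} (h : ℝ) (σ : Fin m → Fin 2) : Fin (m + 1) → ℝ :=
  Fin.snoc (fun j : Fin m => h * labelSign (σ j)) 0

@[simp] theorem cubeMass_castSucc (m : ℕ) (w : ℝ) (j : Fin m) :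
    cubeMass m w j.castSucc = w := by simp [cubeMass]

@[simp] theorem cubeMass_last (m : ℕ) (w : ℝ) : cubeMass m w (Fin.last m) = 1 - m * w := by
  simp [cubeMass]

@[simp] theorem cubeOffset_castSucc {m : ℕ} (h : ℝ) (σ : Fin m → Fin 2) (j : Fin m) :
    cubeOffset h σ j.castSucc = h * labelSign (σ j) := by simp [cubeOffset]

@[simp] theorem cubeOffset_last {m : ℕ} (h : ℝ) (σ : Fin m → Fin 2) :
    cubeOffset h σ (Fin.last m) = 0 := by simp [cubeOffset]

theorem sum_cubeMass (m : ℕ) (w : ℝ) : ∑ i, cubeMass m w i = 1 := by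
  simp [Fin.sum_univ_castSucc]

theorem abs_cubeOffset_le {m : ℕ} {h : ℝ} (hh : 0 ≤ h) (σ : Fin m → Fin 2) (i : Fin (m + 1)) :
    |cubeOffset h σ i| ≤ h := by
  refine Fin.lastCases ?_ (fun j => ?_) i
  · simpa using hh
  · simp [abs_mul, abs_labelSign, abs_of_nonneg hh]

theorem cubeMass_pos {m : ℕ} {w : ℝ} (hw : 0 < w) (hmw : m * w < 1) (i : Fin (m + 1)) :
    0 < cubeMass m w i := by
  refine Fin.lastCases ?_ (fun j => ?_) i
  · simpa using hmw
  · simpa using hw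

/-- Flipping the `j`-th label. -/
def flipAt {m : ℕ} (j : Fin m) (σ : Fin m → Fin 2) : Fin m → Fin 2 :=
  Function.update σ j (1 - σ j)

theorem flipAt_involutive {m : ℕ} (j : Fin m) : Function.Involutive (flipAt j) := by
  intro σ
  simp [flipAt]

theorem sub_le_sum_sqrt_flip {m : ℕ} {w h : ℝ} (hw : 0 < w) (hmw : m * w < 1) (hh : 0 ≤ h)
    (hh2 : h ≤ 1 / 2) (σ : Fin m → Fin 2) (j : Fin m) :
    1 - 4 * h ^ 2 * w ≤ ∑ z, √(atomWeight (cubeMass m w) (cubeOffset h σ) z *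
      atomWeight (cubeMass m w) (cubeOffset h (flipAt j σ)) z) := by
  have hnn : ∀ z, 0 ≤ atomWeight (cubeMass m w) (cubeOffset h σ) z :=
    atomWeight_nonneg (fun i => (cubeMass_pos hw hmw i).le)
      fun i => (abs_cubeOffset_le hh σ i).trans hh2
  -- The affinity is bounded atom by atom; only the flipped atom loses anything.
  have key : ∀ i : Fin (m + 1), cubeMass m w i - (if i = j.castSucc then 4 * h ^ 2 * w else 0) ≤
      ∑ y, √(atomWeight (cubeMass m w) (cubeOffset h σ) (i, y) *
        atomWeight (cubeMass m w) (cubeOffset h (flipAt j σ)) (i, y)) := by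
    intro i
    split_ifs with hi
    · subst hi
      have hprod : ∀ y, atomWeight (cubeMass m w) (cubeOffset h σ) (j.castSucc, y) *
          atomWeight (cubeMass m w) (cubeOffset h (flipAt j σ)) (j.castSucc, y) =
          w ^ 2 * (1 / 4 - h ^ 2) := by
        intro y
        simp only [atomWeight, cubeMass_castSucc, cubeOffset_castSucc, flipAt,
          Function.update_self]
        generalize σ j = s
        fin_cases s <;> fin_cases y <;> simp [labelSign] <;> ring
      simp_rw [hprod]
      -- This is `√(1 - x) ≥ 1 - x` with `x = 4 * h ^ 2`, scaled by `w / 2`.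
      have hge : w * (1 / 2 - 2 * h ^ 2) ≤ √(w ^ 2 * (1 / 4 - h ^ 2)) := by
        refine Real.le_sqrt_of_sq_le ?_
        rw [mul_pow]
        refine mul_le_mul_of_nonneg_left ?_ (sq_nonneg w)
        nlinarith [mul_nonneg hh hh, mul_nonneg (sq_nonneg h) (by nlinarith : 0 ≤ 1 - 4 * h ^ 2)]
      rw [Fin.sum_univ_two, cubeMass_castSucc]
      linarith
    · have hoff : cubeOffset h (flipAt j σ) i = cubeOffset h σ i := by
        revert hi
        refine Fin.lastCases (fun _ => by simp) (fun l hl => ?_) i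
        have : l ≠ j := fun e => hl (by rw [e])
        simp [flipAt, Function.update_of_ne this]
      have hprod : ∀ y, atomWeight (cubeMass m w) (cubeOffset h (flipAt j σ)) (i, y) =
          atomWeight (cubeMass m w) (cubeOffset h σ) (i, y) := fun y => by
        simp only [atomWeight, hoff]
      simp_rw [hprod, Real.sqrt_mul_self (hnn _), sum_atomWeight_label, sub_zero]
      exact le_rfl
  rw [Fintype.sum_prod_type]
  refine le_trans (le_of_eq ?_) (Finset.sum_le_sum fun i _ => key i)
  rw [Finset.sum_sub_distrib, sum_cubeMass, Finset.sum_ite_eq' Finset.univ]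
  simp

/-- The Bayes rule at the `j`-th atom is `σ j`, and the last atom has offset `0`, so every decision
there is equally good and it drops out. -/
theorem excessRisk_cube {k n m : ℕ} {w h : ℝ} (hw : 0 < w) (hmw : m * w < 1) (hh : 0 < h)
    (f : Classifier (k + 1) n) (σ : Fin m → Fin 2)
    (μ : Measure (Fin (m + 1) × Fin 2)) [IsProbabilityMeasure μ]
    (hμ : ∀ z, μ.real {z} = atomWeight (cubeMass m w) (cubeOffset h σ) z)
    (P : ProbabilityMeasure (EuclideanSpace ℝ (Fin (k + 1)) × Fin 2))
    (hP : (P : Measure (EuclideanSpace ℝ (Fin (k + 1)) × Fin 2)) =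
      μ.map (Prod.map (gridPoint k) id)) :
    excessRisk f P = 2 * h * w * ∑ j : Fin m, ∑ D : Fin n → Fin (m + 1) × Fin 2,
      if f.toFun (Prod.map (gridPoint k) id ∘ D) (gridPoint k j.castSucc) ≠ σ j then
        ∏ l, atomWeight (cubeMass m w) (cubeOffset h σ) (D l) else 0 := by
  have hbayes : ∀ j : Fin m, bayesClassifier P (gridPoint k j.castSucc) = σ j := by
    intro j
    rw [bayesClassifier, regressionFn_map (gridPoint_injective k _) (cubeMass_pos hw hmw) μ hμ P hP,
      cubeOffset_castSucc]
    generalize σ j = s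
    fin_cases s
    · simp [labelSign, hh]
    · simp [labelSign, hh.le]
  rw [excessRisk_map f (gridPoint_injective k _) μ P hP, Finset.sum_comm, Finset.mul_sum]
  refine Finset.sum_congr rfl fun D _ => ?_
  rw [measureReal_label_ne μ hμ (fun i => f.toFun (Prod.map (gridPoint k) id ∘ D) (gridPoint k i)),
    measureReal_label_ne μ hμ (fun i => bayesClassifier P (gridPoint k i)),
    ← Finset.sum_sub_distrib, Fin.sum_univ_castSucc]
  simp only [hμ, cubeMass_castSucc, cubeOffset_castSucc, cubeOffset_last, hbayes, mul_zero,
    sub_self, add_zero, Finset.mul_sum]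
  refine Finset.sum_congr rfl fun j _ => ?_
  have := labelSign_sub_mul
    (f.toFun (Prod.map (gridPoint k) id ∘ D) (gridPoint k j.castSucc)) (σ j)
  split_ifs at this ⊢ with hne
  · linear_combination (∏ l, atomWeight (cubeMass m w) (cubeOffset h σ) (D l)) * w * h * this
  · linear_combination (∏ l, atomWeight (cubeMass m w) (cubeOffset h σ) (D l)) * w * h * this

/-- For each coordinate, pair every sign vector with its flip: each pair has total error at least `b
/ 2`, so the mean error per coordinate is at least `b / 4`. Some vector attains at least the mean of
the sum over coordinates. -/
theorem exists_le_sum_error {Z : Type*} [Fintype Z] {n m : ℕ} (p : (Fin m → Fin 2) → Z → ℝ)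
    (hp : ∀ σ z, 0 ≤ p σ z) (hp1 : ∀ σ, ∑ z, p σ z = 1) {b : ℝ}
    (hb : ∀ σ j, b ≤ (∑ z, √(p σ z * p (flipAt j σ) z)) ^ (2 * n))
    (g : (Fin n → Z) → Fin m → Fin 2) :
    ∃ σ, m * (b / 4) ≤ ∑ j, ∑ D : Fin n → Z, if g D j ≠ σ j then ∏ l, p σ (D l) else 0 := by
  set A : (Fin m → Fin 2) → Fin m → ℝ := fun σ j =>
    ∑ D : Fin n → Z, if g D j ≠ σ j then ∏ l, p σ (D l) else 0 with hA
  have hpair : ∀ σ j, b / 2 ≤ A σ j + A (flipAt j σ) j := by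
    intro σ j
    refine (div_le_div_of_nonneg_right (hb σ j) two_pos.le).trans
      ((two_point_lower_bound n (hp σ) (hp _) (hp1 σ) (hp1 _)
        fun D => g D j ≠ σ j).trans (le_of_eq ?_))
    rw [hA, ← Finset.sum_add_distrib]
    refine Finset.sum_congr rfl fun D _ => ?_
    have hflip : g D j ≠ flipAt j σ j ↔ g D j = σ j := by
      simp only [flipAt, Function.update_self]
      generalize g D j = a
      generalize σ j = c
      fin_cases a <;> fin_cases c <;> decide
    by_cases h : g D j = σ j
    · rw [if_neg (not_not.2 h), if_neg (not_not.2 h), if_pos (hflip.2 h), zero_add]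
    · rw [if_pos h, if_pos h, if_neg (mt hflip.1 h), add_zero]
  have hcol : ∀ j, ∑ _σ : Fin m → Fin 2, b / 4 ≤ ∑ σ, A σ j := by
    intro j
    have h1 : ∑ σ, A (flipAt j σ) j = ∑ σ, A σ j :=
      Equiv.sum_comp (flipAt_involutive j).toPerm fun σ => A σ j
    have h2 := Finset.sum_le_sum fun (σ : Fin m → Fin 2) (_ : σ ∈ Finset.univ) => hpair σ j
    rw [Finset.sum_add_distrib, h1] at h2
    have h3 : ∑ _σ : Fin m → Fin 2, b / 2 = 2 * ∑ _σ : Fin m → Fin 2, b / 4 := by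
      rw [Finset.mul_sum]
      exact Finset.sum_congr rfl fun _ _ => by ring
    linarith
  have htot : ∑ _σ : Fin m → Fin 2, m * (b / 4) ≤ ∑ σ, ∑ j, A σ j := by
    rw [Finset.sum_comm]
    refine le_trans (le_of_eq ?_) (Finset.sum_le_sum fun j _ => hcol j)
    simp only [Finset.sum_const, Finset.card_univ, Fintype.card_fin, nsmul_eq_mul]
    ring
  obtain ⟨σ, -, hσ⟩ := Finset.exists_le_of_sum_le Finset.univ_nonempty htot
  exact ⟨σ, hσ⟩

theorem le_minimaxExcessRisk_cube {k n m : ℕ} {α C₀ κ w h : ℝ} (hα : 0 ≤ α)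
    (hκ : 0 < κ) (hw : 0 < w) (hmw : m * w < 1) (hh : 0 < h) (hhκ : h ≤ 1 / 2 - κ)
    (hC₀ : 0 ≤ C₀) (hmargin : m * w ≤ C₀ * h ^ α) :
    ((h * w * m / 2 * max 0 (1 - 8 * n * h ^ 2 * w) : ℝ) : EReal) ≤
      minimaxExcessRisk n (distributionClass (k + 1) α C₀ κ) := by
  have hh2 : h ≤ 1 / 2 := by linarith
  refine le_iInf fun f => ?_
  set p : (Fin m → Fin 2) → Fin (m + 1) × Fin 2 → ℝ := fun σ =>
    atomWeight (cubeMass m w) (cubeOffset h σ)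
  have hp : ∀ σ z, 0 ≤ p σ z := fun σ =>
    atomWeight_nonneg (fun i => (cubeMass_pos hw hmw i).le)
      fun i => (abs_cubeOffset_le hh.le σ i).trans hh2
  have hp1 : ∀ σ, ∑ z, p σ z = 1 := fun σ => (sum_atomWeight _ _).trans (sum_cubeMass m w)
  have hb : ∀ σ j, max 0 (1 - 8 * n * h ^ 2 * w) ≤
      (∑ z, √(p σ z * p (flipAt j σ) z)) ^ (2 * n) := by
    intro σ j
    refine max_le (pow_nonneg (Finset.sum_nonneg fun _ _ => Real.sqrt_nonneg _) _) ?_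
    -- The index `j` forces `m ≥ 1`, hence `w ≤ 1`, which keeps the base in Bernoulli's inequality
    -- nonnegative.
    have hm1 : (1 : ℝ) ≤ m := by exact_mod_cast (Fin.pos j)
    have hw1 : w ≤ 1 := by nlinarith
    have h4 : 4 * h ^ 2 * w ≤ 1 := by nlinarith [sq_nonneg h]
    have hbern := one_add_mul_le_pow (a := -(4 * h ^ 2 * w)) (by linarith) (2 * n)
    push_cast at hbern
    calc 1 - 8 * n * h ^ 2 * w = 1 + 2 * n * -(4 * h ^ 2 * w) := by ring
      _ ≤ (1 + -(4 * h ^ 2 * w)) ^ (2 * n) := hbern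
      _ ≤ _ := pow_le_pow_left₀ (by linarith)
        (by simpa [sub_eq_add_neg] using sub_le_sum_sqrt_flip hw hmw hh.le hh2 σ j) _
  obtain ⟨σ, hσ⟩ := exists_le_sum_error p hp hp1 hb fun D j =>
    f.toFun (Prod.map (gridPoint k) id ∘ D) (gridPoint k j.castSucc)
  obtain ⟨μ, hμprob, hμ⟩ := exists_isProbabilityMeasure_real_singleton (p σ) (hp σ) (hp1 σ)
  have hprob : IsProbabilityMeasure (μ.map (Prod.map (gridPoint k) (id : Fin 2 → Fin 2))) :=
    Measure.isProbabilityMeasure_map (measurable_of_finite _).aemeasurable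
  set P : ProbabilityMeasure (EuclideanSpace ℝ (Fin (k + 1)) × Fin 2) := ⟨_, hprob⟩
  have hmem : P ∈ distributionClass (k + 1) α C₀ κ := by
    refine mem_distributionClass m.succ_pos hκ (cubeMass_pos hw hmw)
      (fun i => (abs_cubeOffset_le hh.le σ i).trans hhκ) (fun t ht => ?_) μ hμ P rfl
    rw [Fin.sum_univ_castSucc]
    simp only [cubeOffset_last, abs_zero, lt_irrefl, false_and, if_false, add_zero,
      cubeOffset_castSucc, abs_mul, abs_labelSign, mul_one, abs_of_pos hh, hh, true_and,
      cubeMass_castSucc, Finset.sum_const, Finset.card_univ, Fintype.card_fin, nsmul_eq_mul]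
    -- All nonzero offsets have size `h`, so the margin mass jumps from `0` to `m * w` at `t = h`.
    split_ifs with hht
    · exact hmargin.trans
        (mul_le_mul_of_nonneg_left (Real.rpow_le_rpow hh.le hht hα) hC₀)
    · rw [mul_zero]
      positivity
  refine le_trans (EReal.coe_le_coe_iff.2 ?_) (le_iSup₂_of_le P hmem le_rfl)
  rw [excessRisk_cube hw hmw hh f σ μ hμ P rfl]
  refine le_trans (le_of_eq ?_) (mul_le_mul_of_nonneg_left hσ (by positivity))
  ring

/-! ### Fitting the hypercube to the margin and noise constants. -/

/-- The constant of the lower bound. -/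
noncomputable def riskConst (α C₀ κ : ℝ) : ℝ :=
  (1 / 2 - κ) * min (1 / 2) (C₀ * (2 * (1 / 2 - κ)) ^ α) / 2

theorem riskConst_pos {α C₀ κ : ℝ} (hC₀ : 0 < C₀) (hκ' : κ < 1 / 2) : 0 < riskConst α C₀ κ := by
  have ha : 0 < 1 / 2 - κ := by linarith
  have : 0 < min (1 / 2) (C₀ * (2 * (1 / 2 - κ)) ^ α) := lt_min (by norm_num) (by positivity)
  unfold riskConst
  positivity

theorem le_minimaxExcessRisk {α C₀ κ : ℝ} (hα : 0 ≤ α) (hC₀ : 0 < C₀) (hκ : 0 < κ)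
    (hκ' : κ < 1 / 2) {d : ℕ} (hd : 1 ≤ d) {n q m : ℕ} {r w : ℝ} (hq : 1 ≤ q) (hm : 1 ≤ m)
    (hr : 0 < r) (hw : 0 < w) (hwm : w ≤ 1 / (m : ℝ))
    (hmargin : w * (m : ℝ) ≤ (q : ℝ) ^ (-(r * α)) / (2 : ℝ) ^ α) :
    ((riskConst α C₀ κ * (q : ℝ) ^ (-r) * (m : ℝ) * w *
      (1 - (q : ℝ) ^ (-r) * √((n : ℝ) * w)) : ℝ) : EReal) ≤
      minimaxExcessRisk n (distributionClass d α C₀ κ) := by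
  obtain ⟨k, rfl⟩ : ∃ k, d = k + 1 := ⟨d - 1, by omega⟩
  set a : ℝ := 1 / 2 - κ with ha_def
  have ha : 0 < a := by linarith
  -- Atoms get mass `c * w` and offset `a * u`. The factor `1 / 2` leaves positive mass for the last
  -- atom and gives `8 * a ^ 2 * c ≤ 1`; the other factor absorbs `C₀` and `2 ^ α` in the margin
  -- condition.
  set c : ℝ := min (1 / 2) (C₀ * (2 * a) ^ α) with hc_def
  have hc : 0 < c := lt_min (by norm_num) (by positivity)
  have hc2 : c ≤ 1 / 2 := min_le_left _ _
  have hq0 : (0 : ℝ) < q := by exact_mod_cast hq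
  have hq1 : (1 : ℝ) ≤ q := by exact_mod_cast hq
  have hm0 : (0 : ℝ) < m := by exact_mod_cast hm
  set u : ℝ := (q : ℝ) ^ (-r) with hu_def
  have hu : 0 < u := Real.rpow_pos_of_pos hq0 _
  have hu1 : u ≤ 1 := Real.rpow_le_one_of_one_le_of_nonpos hq1 (by linarith)
  have huα : (q : ℝ) ^ (-(r * α)) = u ^ α := by
    rw [hu_def, ← Real.rpow_mul hq0.le, neg_mul]
  have hmw1 : m * w ≤ 1 := by
    have := mul_le_mul_of_nonneg_left hwm hm0.le
    rwa [mul_one_div_cancel hm0.ne'] at this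
  have hmar : m * (c * w) ≤ C₀ * (a * u) ^ α := by
    rw [huα] at hmargin
    calc m * (c * w) = c * (w * m) := by ring
      _ ≤ (C₀ * (2 * a) ^ α) * (u ^ α / 2 ^ α) :=
        mul_le_mul (min_le_right _ _) hmargin (by positivity) (by positivity)
      _ = C₀ * (a * u) ^ α := by
        rw [Real.mul_rpow two_pos.le ha.le, Real.mul_rpow ha.le hu.le]
        field_simp
  have hmain := le_minimaxExcessRisk_cube (k := k) (n := n) (m := m) hα hκ (mul_pos hc hw)
    (by nlinarith) (mul_pos ha hu) (by nlinarith) hC₀.le hmar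
  refine le_trans (EReal.coe_le_coe_iff.2 ?_) hmain
  set s : ℝ := u * √(n * w) with hs_def
  have hs0 : 0 ≤ s := by positivity
  have hs2 : s ^ 2 = u ^ 2 * (n * w) := by
    rw [hs_def, mul_pow, Real.sq_sqrt (by positivity)]
  have hac : 8 * a ^ 2 * c ≤ 1 := by
    have : a ≤ 1 / 2 := by linarith
    nlinarith [mul_pos ha ha]
  have hs3 : 8 * n * (a * u) ^ 2 * (c * w) ≤ s ^ 2 := by
    calc 8 * n * (a * u) ^ 2 * (c * w) = (8 * a ^ 2 * c) * s ^ 2 := by rw [hs2]; ring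
      _ ≤ 1 * s ^ 2 := mul_le_mul_of_nonneg_right hac (sq_nonneg s)
      _ = s ^ 2 := one_mul _
  -- For `s ≤ 1` use `s ^ 2 ≤ s`; for larger `s` the left side is nonpositive and the maximum with
  -- `0` takes over.
  have hle : 1 - s ≤ max 0 (1 - 8 * n * (a * u) ^ 2 * (c * w)) := by
    rcases le_total s 1 with h | h
    · exact le_max_of_le_right (by nlinarith)
    · exact le_max_of_le_left (by linarith)
  calc riskConst α C₀ κ * u * m * w * (1 - s) = a * u * (c * w) * m / 2 * (1 - s) := by
        rw [riskConst]; ring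
    _ ≤ _ := mul_le_mul_of_nonneg_left hle (by positivity)

/-! ### The explicit rate. -/

theorem two_thirds_mul_le_floor {z : ℝ} (hz : 2 ≤ z) : 2 / 3 * z ≤ ⌊z⌋₊ := by
  rcases le_total z 3 with h | h
  · have : (2 : ℝ) ≤ ⌊z⌋₊ := by exact_mod_cast Nat.le_floor (by exact_mod_cast hz)
    linarith
  · linarith [Nat.lt_floor_add_one z]

theorem rate_choice {α C Cbar : ℝ} (hα : 0 ≤ α) (hC : 0 < C) (hCbar : 2 ≤ Cbar) {d n q m : ℕ}
    {r w : ℝ} (hd : 1 ≤ d) (hn : 1 ≤ n) (hr : r = (d : ℝ) / (2 * (2 + α)))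
    (hq : q = ⌊Cbar * (n : ℝ) ^ (1 / (3 * r * (2 + α)))⌋₊) (hm : m = q ^ d)
    (hw : w = (q : ℝ) ^ (-(α * r) - (d : ℝ)) / (2 : ℝ) ^ α) :
    (1 ≤ q ∧ 0 < w ∧ w ≤ 1 / (m : ℝ) ∧ w * (m : ℝ) ≤ (q : ℝ) ^ (-(r * α)) / (2 : ℝ) ^ α) ∧
      C * (Cbar ^ (-((1 + α) * r)) / (2 : ℝ) ^ α / 8) *
        (n : ℝ) ^ (-((1 + α) / (3 * (2 + α)))) ≤
        C * (q : ℝ) ^ (-r) * (m : ℝ) * w * (1 - (q : ℝ) ^ (-r) * √((n : ℝ) * w)) := by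
  have hd0 : (0 : ℝ) < d := by exact_mod_cast hd
  have hd1 : (1 : ℝ) ≤ d := by exact_mod_cast hd
  have hn0 : (0 : ℝ) < n := by exact_mod_cast hn
  have hn1 : (1 : ℝ) ≤ n := by exact_mod_cast hn
  have hα2 : 0 < 2 + α := by linarith
  have hr0 : 0 < r := by rw [hr]; positivity
  have hexp : 1 / (3 * r * (2 + α)) = 2 / (3 * d) := by
    rw [hr]; field_simp
  rw [hexp] at hq
  set y : ℝ := (n : ℝ) ^ (2 / (3 * d) : ℝ) with hy
  have hy1 : 1 ≤ y := Real.one_le_rpow hn1 (by positivity)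
  have hy0 : 0 < y := by linarith
  have hz : 2 ≤ Cbar * y := by nlinarith
  -- The floor loses at most a third and `Cbar ≥ 2`, so `q` exceeds `y` by a fixed factor above `1`;
  -- this keeps the last bracket away from `0`.
  have hqlow : 4 / 3 * y ≤ q := by
    have := two_thirds_mul_le_floor hz
    rw [← hq] at this
    nlinarith
  have hqup : (q : ℝ) ≤ Cbar * y := by
    rw [hq]; exact Nat.floor_le (by linarith)
  have hq1' : (1 : ℝ) ≤ q := by linarith
  have hq0 : (0 : ℝ) < q := by linarith
  have hq1 : 1 ≤ q := by exact_mod_cast hq1'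
  have h2α : (1 : ℝ) ≤ 2 ^ α := Real.one_le_rpow one_le_two hα
  have h2α0 : (0 : ℝ) < 2 ^ α := by linarith
  have hw0 : 0 < w := by rw [hw]; exact div_pos (Real.rpow_pos_of_pos hq0 _) h2α0
  have hmr : (m : ℝ) = (q : ℝ) ^ (d : ℝ) := by rw [hm]; push_cast; rw [Real.rpow_natCast]
  have hm0 : (0 : ℝ) < m := by rw [hmr]; exact Real.rpow_pos_of_pos hq0 _
  have hwm : w * m = (q : ℝ) ^ (-(r * α)) / 2 ^ α := by
    rw [hw, hmr, div_mul_eq_mul_div, ← Real.rpow_add hq0]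
    congr 2; ring
  have hwm1 : w * m ≤ 1 := by
    rw [hwm, div_le_one h2α0]
    exact (Real.rpow_le_one_of_one_le_of_nonpos hq1' (by nlinarith)).trans h2α
  refine ⟨⟨hq1, hw0, (le_div_iff₀ hm0).2 hwm1, hwm.le⟩, ?_⟩
  -- With this `r` the square equals `n * q ^ (-3d/2) / 2 ^ α`, while `y ^ (3d/2) = n`. The exponent
  -- `3d/2` is at least `1`, so the factor `4 / 3` survives.
  have hs2 : ((q : ℝ) ^ (-r) * √(n * w)) ^ 2 ≤ 3 / 4 := by
    have h1 : ((q : ℝ) ^ (-r) * √(n * w)) ^ 2 = n * (q : ℝ) ^ (-(3 * d / 2 : ℝ)) / 2 ^ α := by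
      rw [mul_pow, Real.sq_sqrt (by positivity), ← Real.rpow_natCast, ← Real.rpow_mul hq0.le, hw]
      have : (-(3 * d / 2 : ℝ)) = -r * (2 : ℕ) + (-(α * r) - d) := by
        rw [hr]; push_cast; field_simp; ring
      rw [this, Real.rpow_add hq0]
      ring
    have h2 : (n : ℝ) * (4 / 3) ≤ (q : ℝ) ^ (3 * d / 2 : ℝ) := by
      calc (n : ℝ) * (4 / 3) ≤ n * (4 / 3) ^ (3 * d / 2 : ℝ) := by
            refine mul_le_mul_of_nonneg_left ?_ hn0.le
            exact Real.self_le_rpow_of_one_le (by norm_num) (by linarith)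
        _ = (4 / 3 * y) ^ (3 * d / 2 : ℝ) := by
            rw [Real.mul_rpow (by norm_num) hy0.le, hy, ← Real.rpow_mul hn0.le]
            rw [show (2 / (3 * d) * (3 * d / 2) : ℝ) = 1 by field_simp, Real.rpow_one, mul_comm]
        _ ≤ _ := Real.rpow_le_rpow (by positivity) hqlow (by positivity)
    rw [h1, Real.rpow_neg hq0.le, div_le_iff₀ h2α0]
    have hQ : 0 < (q : ℝ) ^ (3 * d / 2 : ℝ) := Real.rpow_pos_of_pos hq0 _
    have h3 : (n : ℝ) * ((q : ℝ) ^ (3 * d / 2 : ℝ))⁻¹ ≤ 3 / 4 := by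
      rw [← div_eq_mul_inv, div_le_iff₀ hQ]
      linarith
    linarith
  -- `(7 / 8) ^ 2 = 49 / 64` is just above `3 / 4`.
  have hs : (1 : ℝ) / 8 ≤ 1 - (q : ℝ) ^ (-r) * √(n * w) := by
    have := abs_le_of_sq_le_sq (a := (q : ℝ) ^ (-r) * √(n * w)) (b := 7 / 8)
      (hs2.trans (by norm_num)) (by norm_num)
    linarith [(abs_le.1 this).2]
  have hpow : Cbar ^ (-((1 + α) * r)) * (n : ℝ) ^ (-((1 + α) / (3 * (2 + α)))) ≤
      (q : ℝ) ^ (-r) * (q : ℝ) ^ (-(r * α)) := by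
    have h1 : (n : ℝ) ^ (-((1 + α) / (3 * (2 + α)))) = y ^ (-((1 + α) * r)) := by
      rw [hy, ← Real.rpow_mul hn0.le]
      congr 1
      rw [hr]; field_simp
    rw [h1, ← Real.mul_rpow (by linarith) hy0.le, ← Real.rpow_add hq0,
      show -r + -(r * α) = -((1 + α) * r) by ring]
    exact Real.rpow_le_rpow_of_nonpos hq0 hqup (by nlinarith)
  calc C * (Cbar ^ (-((1 + α) * r)) / (2 : ℝ) ^ α / 8) * (n : ℝ) ^ (-((1 + α) / (3 * (2 + α))))
      = C / 2 ^ α * (Cbar ^ (-((1 + α) * r)) * (n : ℝ) ^ (-((1 + α) / (3 * (2 + α))))) *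
          (1 / 8) := by ring
    _ ≤ C / 2 ^ α * ((q : ℝ) ^ (-r) * (q : ℝ) ^ (-(r * α))) *
          (1 - (q : ℝ) ^ (-r) * √(n * w)) := by gcongr
    _ = C * (q : ℝ) ^ (-r) * (w * m) * (1 - (q : ℝ) ^ (-r) * √(n * w)) := by rw [hwm]; ring
    _ = _ := by ring

end BarronMinimax

theorem mainTheorem4 (α C₀ κ : ℝ) (hα : 0 ≤ α) (hC₀ : 0 < C₀) (hκ : 0 < κ) (hκ' : κ < 1 / 2) :
    ∃ C : ℝ, 0 < C ∧ ∀ d : ℕ, 1 ≤ d →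
      (∀ (n q m : ℕ) (r w : ℝ), 1 ≤ n → 1 ≤ q → 1 ≤ m → 0 < r → 0 < w →
        m ≤ q ^ d → w ≤ 1 / (m : ℝ) →
        w * (m : ℝ) ≤ (q : ℝ) ^ (-(r * α)) / (2 : ℝ) ^ α →
        ((C * (q : ℝ) ^ (-r) * (m : ℝ) * w * (1 - (q : ℝ) ^ (-r) * √((n : ℝ) * w)) : ℝ) : EReal)
          ≤ BarronMinimax.minimaxExcessRisk n (BarronMinimax.distributionClass d α C₀ κ)) ∧
      (∀ Cbar : ℝ, 2 ≤ Cbar → ∃ C' : ℝ, 0 < C' ∧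
        ∀ (n q m : ℕ) (r w : ℝ), 1 ≤ n →
          r = (d : ℝ) / (2 * (2 + α)) →
          q = ⌊Cbar * (n : ℝ) ^ (1 / (3 * r * (2 + α)))⌋₊ →
          m = q ^ d →
          w = (q : ℝ) ^ (-(α * r) - (d : ℝ)) / (2 : ℝ) ^ α →
          (1 ≤ q ∧ 0 < w ∧ w ≤ 1 / (m : ℝ) ∧
            w * (m : ℝ) ≤ (q : ℝ) ^ (-(r * α)) / (2 : ℝ) ^ α) ∧
          C' * (n : ℝ) ^ (-((1 + α) / (3 * (2 + α)))) ≤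
            C * (q : ℝ) ^ (-r) * (m : ℝ) * w * (1 - (q : ℝ) ^ (-r) * √((n : ℝ) * w)) ∧
          ((C' * (n : ℝ) ^ (-((1 + α) / (3 * (2 + α)))) : ℝ) : EReal)
            ≤ BarronMinimax.minimaxExcessRisk n (BarronMinimax.distributionClass d α C₀ κ)) := by
  refine ⟨BarronMinimax.riskConst α C₀ κ, BarronMinimax.riskConst_pos hC₀ hκ', fun d hd => ⟨?_, ?_⟩⟩
  · intro n q m r w _ hq hm hr hw _ hwm hmargin
    exact BarronMinimax.le_minimaxExcessRisk hα hC₀ hκ hκ' hd hq hm hr hw hwm hmargin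
  · intro Cbar hCbar
    have hC := BarronMinimax.riskConst_pos (α := α) hC₀ hκ'
    have hCbar0 : 0 < Cbar := by linarith
    refine ⟨BarronMinimax.riskConst α C₀ κ *
      (Cbar ^ (-((1 + α) * ((d : ℝ) / (2 * (2 + α))))) / (2 : ℝ) ^ α / 8), by positivity,
      fun n q m r w hn hr hq hm hw => ?_⟩
    obtain ⟨⟨hq1, hw0, hwm, hmargin⟩, hrate⟩ :=
      BarronMinimax.rate_choice hα hC hCbar hd hn hr hq hm hw
    rw [← hr]
    have hd0 : (0 : ℝ) < d := by exact_mod_cast hd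
    have hr0 : 0 < r := by rw [hr]; positivity
    refine ⟨⟨hq1, hw0, hwm, hmargin⟩, hrate, (EReal.coe_le_coe_iff.2 hrate).trans ?_⟩
    exact BarronMinimax.le_minimaxExcessRisk hα hC₀ hκ hκ' hd hq1
      (hm ▸ Nat.one_le_pow _ _ hq1) hr0 hw0 hwm hmargin
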